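/- **Setting.** There are $n$ users and $k$ arms. User $i$ has an unknown parameter $\theta_i\in\mathbb R^d$. In round $t=1,2,\dots$ a user $i_t$ is served and contexts $x_{1,t},\dots,x_{k,t}\in\mathbb R^d$ are revealed. Conditionally on $i_t$ and the past data, these are i.i.d. copies of a random vector $X$ with $\|X\|=1$ such that $\mathbb E[XX^{\top}]$ has smallest eigenvalue $\lambda>0$. The learner pulls some $x_t\in\{x_{1,t},\dots,x_{k,t}\}$ and observes $r_t=\theta_{i_t}^{\top}x_t+\eta_t$, where $\eta_t\sim\mathcal N(0,\sigma^2)$, $\sigma>0$, is independent of what precedes it. Let $m_{i,t}$ be the number of rounds among $1,\dots,t$ in which user $i$ is served, and put $$A_{i,t}=I+\sum_{s\le t,\ i_s=i}x_sx_s^{\top},\qquad b_{i,t}=\sum_{s\le t,\ i_s=i}r_sx_s,\qquad \hat\theta_{i,t}=A_{i,t}^{-1}b_{i,t}.$$ Let $\gamma>0$, $0<\delta<1$, $\delta'=\delta/n$, $H=\delta'/(2nd)$. The confidence radius is $$B_{i,t}=\frac{\sigma\sqrt{2d\log t+2\log(2/\delta')}+1}{\sqrt{1+h(m_{i,t},H)}},\qquad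 h(m,H)=\Big(\tfrac{\lambda m}{4}-8\log\tfrac{m+3}{H}-2\sqrt{m\log\tfrac{m+3}{H}}\Big)_+ .$$ **Clustering module of LOCB.** Given a set $S$ of seed users, every seed $s\in S$ is initially active and has cluster $\mathcal N_{s,0}=\{1,\dots,n\}$. At the end of round $t$, for each active seed $s$: if $\|\hat\theta_{i_t,t}-\hat\theta_{s,t}\|>B_{i_t,t}+B_{s,t}$ then $\mathcal N_{s,t}=\mathcal N_{s,t-1}\setminus\{i_t\}$, otherwise $\mathcal N_{s,t}=\mathcal N_{s,t-1}\cup\{i_t\}$; then $s$ becomes inactive, and its cluster is frozen, if $\sup_{i\in\mathcal N_{s,t}}B_{i,t}<\gamma/8$. The module terminates at the first round $\hat T$ after which no seed is active. **Pulling module of LOCB.** With an exploration parameter $\alpha$, write $\beta_{j,t}(x)=\alpha\sqrt{x^{\top}A_{j,t}^{-1}x}$. If some of the current clusters $\mathcal N_{s,t-1}$, $s\in S$, contain $i_t$, the pulled arm maximizes over $x\in\{x_{1,t},\dots,x_{k,t}\}$ the largest value, over these clusters, of $\frac1{|\mathcal N_{s,t-1}|}\sum_{j\in\mathcal N_{s,t-1}}\big(\hat\theta_{j,t-1}^{\top}x+\beta_{j,t-1}(x)\big)$;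 otherwise it maximizes $\hat\theta_{i_t,t-1}^{\top}x+\beta_{i_t,t-1}(x)$. **Theorem.** Let $C=\dfrac{\lambda\gamma^2}{16^3\sigma^2}$ and $$\bar U=\frac{2nd}{C}\log\frac{nd}{C}+\frac{2n}{C}\Big(\log\frac{2^{d+1}n}{\delta}-\frac{\gamma^2-256}{512\sigma^2}\Big)+n .$$ Suppose that the users are served evenly (almost surely, after every $q$ iterations of $n$ rounds each user has been served exactly $q$ times) and that, almost surely, at some round $t$ before termination ($t<\hat T$) or before the bound ($t<\bar U$), for all users $i$, $$m_{i,t}\ \ge\ \frac{2\cdot 32^2}{\lambda^2}\log\Big(\frac{2nd}{\delta'}\Big)\log\Big(\frac{32^2}{\lambda^2}\log\Big(\frac{2nd}{\delta'}\Big)\Big).$$ Then, with probability at least $1-\delta$, the Clustering module terminates and $\hat T<\bar U$. Moreover, for fixed $\sigma,\lambda,\gamma,\delta$, the expression $\bar U$ is $O(n\log n)$ as $n\to\infty$ with $d$ fixed, and $O(nd\log(nd))$ as $n,d\to\infty$. -/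

import Mathlib

open MeasureTheory ProbabilityTheory Filter Asymptotics
open scoped Matrix

noncomputable section

namespace LOCB

/-- The space `ℝ^d` with the Euclidean norm, in which contexts and bandit parameters live. -/
abbrev Vec (d : ℕ) : Type := EuclideanSpace ℝ (Fin d)

/-! ### The confidence radius -/

/-- `h(m, H) = (λ m / 4 - 8 log ((m + 3) / H) - 2 √(m log ((m + 3) / H)))_+`.  The positive part
belongs to the confidence bound of CLUB; it keeps the radius below well defined for small `m`. -/
def hFun (lam : ℝ) (m : ℕ) (H : ℝ) : ℝ :=
  max 0 (lam * m / 4 - 8 * Real.log ((m + 3) / H) - 2 * √(m * Real.log ((m + 3) / H)))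

/-- The confidence radius `B(m, δ')` at round `t` of a user that has been served `m` times:
`(σ √(2 d log t + 2 log (2 / δ')) + 1) / √(1 + h(m, H))` with `H = δ' / (2 n d)`. -/
def radius (n d : ℕ) (sigma lam delta' : ℝ) (t m : ℕ) : ℝ :=
  (sigma * √(2 * d * Real.log t + 2 * Real.log (2 / delta')) + 1) /
    √(1 + hFun lam m (delta' / (2 * n * d)))

/-! ### Statistics of the users

`Path` records, for each round `t = 1, 2, …`, the served user `i_t`, the pulled context vector
`x_t` and the observed reward `r_t`.  The entries with index `0` are never used. -/

/-- The observations of a learner along one realization. -/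
structure Path (n d : ℕ) where
  user : ℕ → Fin n
  pulled : ℕ → Vec d
  reward : ℕ → ℝ

variable {n d k : ℕ}

/-- The rounds up to `t` in which user `i` is served. -/
def served (p : Path n d) (i : Fin n) (t : ℕ) : Finset ℕ :=
  (Finset.Icc 1 t).filter fun s => p.user s = i

/-- `m_{i,t}`: the number of times that user `i` has been served up to round `t`. -/
def count (p : Path n d) (i : Fin n) (t : ℕ) : ℕ := (served p i t).card

/-- `A_{i,t} = I + ∑ x xᵀ` over the history of user `i` up to round `t`. -/
def gram (p : Path n d) (i : Fin n) (t : ℕ) : Matrix (Fin d) (Fin d) ℝ :=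
  1 + ∑ s ∈ served p i t, Matrix.vecMulVec (p.pulled s).ofLp (p.pulled s).ofLp

/-- `b_{i,t} = ∑ r x` over the history of user `i` up to round `t`. -/
def bVec (p : Path n d) (i : Fin n) (t : ℕ) : Vec d :=
  ∑ s ∈ served p i t, p.reward s • p.pulled s

/-- `θ̂_{i,t} = A_{i,t}⁻¹ b_{i,t}`. -/
def thetaHat (p : Path n d) (i : Fin n) (t : ℕ) : Vec d :=
  WithLp.toLp 2 ((gram p i t)⁻¹ *ᵥ (bVec p i t).ofLp)

/-! ### The Clustering module -/

/-- The current set `S` of seeds still being explored, and the current clusters `𝒩_s`. -/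
structure ClusterState (n : ℕ) where
  active : Finset (Fin n)
  cluster : Fin n → Finset (Fin n)

open Classical in
/-- The cluster of `s` after a round in which user `u` was served: for an active seed, `u` is
removed if its estimate is too far from that of `s`, and kept (or put back) otherwise. -/
def newCluster (B : Fin n → ℝ) (est : Fin n → Vec d) (u : Fin n) (st : ClusterState n)
    (s : Fin n) : Finset (Fin n) :=
  if s ∈ st.active then
    if ‖est u - est s‖ > B u + B s then (st.cluster s).erase u else insert u (st.cluster s)
  else st.cluster s

open Classical in
/-- One call of the Clustering procedure, with confidence radii `B` and estimates `est`: an active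
seed `s` is dropped as soon as `sup {B i : i ∈ 𝒩_s} < γ / 8` (a supremum over a finite set). -/
def clusterStep (gamma : ℝ) (B : Fin n → ℝ) (est : Fin n → Vec d) (u : Fin n)
    (st : ClusterState n) : ClusterState n where
  active := st.active.filter fun s => ¬ ∀ i ∈ newCluster B est u st s, B i < gamma / 8
  cluster := newCluster B est u st

/-- The state of the Clustering module at the end of round `t`, with `δ' = δ / n`.  Initially all
seeds are active and every cluster is the set of all users. -/
def clusterState (sigma lam gamma delta : ℝ) (S : Finset (Fin n)) (p : Path n d) :
    ℕ → ClusterState n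
  | 0 => ⟨S, fun _ => Finset.univ⟩
  | t + 1 => clusterStep gamma
      (fun i => radius n d sigma lam (delta / n) (t + 1) (count p i (t + 1)))
      (fun i => thetaHat p i (t + 1)) (p.user (t + 1))
      (clusterState sigma lam gamma delta S p t)

/-- `T̂`: the number of rounds after which no seed is active any more (`⊤` if this never
happens). -/
def termTime (sigma lam gamma delta : ℝ) (S : Finset (Fin n)) (p : Path n d) : ℕ∞ :=
  sInf ((fun t : ℕ => (t : ℕ∞)) '' {t | (clusterState sigma lam gamma delta S p t).active = ∅})

/-! ### The Pulling module -/

/-- `CB_{r,i} = α √(yᵀ A_{i,t}⁻¹ y)`, for a context vector `y`. -/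
def userBonus (alpha : ℝ) (p : Path n d) (i : Fin n) (t : ℕ) (y : Vec d) : ℝ :=
  alpha * √(y.ofLp ⬝ᵥ ((gram p i t)⁻¹ *ᵥ y.ofLp))

/-- The upper confidence value of the context vector `y` for user `i`. -/
def userScore (alpha : ℝ) (p : Path n d) (i : Fin n) (t : ℕ) (y : Vec d) : ℝ :=
  (thetaHat p i t).ofLp ⬝ᵥ y.ofLp + userBonus alpha p i t y

/-- The upper confidence value of the context vector `y` for a cluster `C`: the average estimate of
`C` applied to `y`, plus the average of the bonuses of its users. -/
def clusterScore (alpha : ℝ) (p : Path n d) (C : Finset (Fin n)) (t : ℕ) (y : Vec d) : ℝ :=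
  ((C.card : ℝ)⁻¹ • ∑ j ∈ C, thetaHat p j t).ofLp ⬝ᵥ y.ofLp +
    (C.card : ℝ)⁻¹ * ∑ j ∈ C, userBonus alpha p j t y

/-- `S_{t+1}(i)`: the seeds whose cluster at the end of round `t` contains user `i`. -/
def seedsOf (sigma lam gamma delta : ℝ) (S : Finset (Fin n)) (p : Path n d) (t : ℕ) (i : Fin n) :
    Finset (Fin n) :=
  S.filter fun s => i ∈ (clusterState sigma lam gamma delta S p t).cluster s

open Classical in
/-- The value of the context vector `y` in round `t + 1`: the largest value among the clusters that
contain the served user, or the value for the user alone if there is no such cluster. -/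
def armScore (sigma lam gamma delta alpha : ℝ) (S : Finset (Fin n)) (p : Path n d) (t : ℕ)
    (y : Vec d) : ℝ :=
  if hS : (seedsOf sigma lam gamma delta S p t (p.user (t + 1))).Nonempty then
    (seedsOf sigma lam gamma delta S p t (p.user (t + 1))).sup' hS fun s =>
      clusterScore alpha p ((clusterState sigma lam gamma delta S p t).cluster s) t y
  else userScore alpha p (p.user (t + 1)) t y

/-! ### The stochastic model -/

variable {Ω : Type*} [MeasurableSpace Ω]

/-- The reward `r_t = θ_{i_t}ᵀ x_t + η_t` of the pulled arm. -/
def reward (theta : Fin n → Vec d) (user : ℕ → Ω → Fin n) (ctx : ℕ → Ω → Fin k → Vec d)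
    (arm : ℕ → Ω → Fin k) (noise : ℕ → Ω → ℝ) (t : ℕ) (ω : Ω) : ℝ :=
  (theta (user t ω)).ofLp ⬝ᵥ (ctx t ω (arm t ω)).ofLp + noise t ω

/-- The observations made along the realization `ω`. -/
def pathOf (theta : Fin n → Vec d) (user : ℕ → Ω → Fin n) (ctx : ℕ → Ω → Fin k → Vec d)
    (arm : ℕ → Ω → Fin k) (noise : ℕ → Ω → ℝ) (ω : Ω) : Path n d where
  user t := user t ω
  pulled t := ctx t ω (arm t ω)
  reward t := reward theta user ctx arm noise t ω

/-- The σ-algebra generated by the data (users, contexts, pulled arms, rewards) of the rounds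
`1, …, t`. -/
abbrev past (theta : Fin n → Vec d) (user : ℕ → Ω → Fin n) (ctx : ℕ → Ω → Fin k → Vec d)
    (arm : ℕ → Ω → Fin k) (noise : ℕ → Ω → ℝ) (t : ℕ) : MeasurableSpace Ω :=
  ⨆ s ∈ Finset.Icc 1 t, MeasurableSpace.comap
    (fun ω => (user s ω, ctx s ω, arm s ω, reward theta user ctx arm noise s ω)) inferInstance

/-- The matrix `E[X Xᵀ]` of a random vector `X` with law `ν`. -/
def secondMoment (ν : Measure (Vec d)) : Matrix (Fin d) (Fin d) ℝ :=
  Matrix.of fun a b => ∫ x, x a * x b ∂ν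

/-- The law `ν` of the random context vector `X`: `‖X‖ = 1`, and `E[X Xᵀ]` has full rank with
smallest eigenvalue `λ > 0`. -/
structure IsContextLaw (ν : Measure (Vec d)) (lam : ℝ) : Prop where
  isProbabilityMeasure : IsProbabilityMeasure ν
  norm_eq_one : ∀ᵐ x ∂ν, ‖x‖ = 1
  isLeast_eigenvalue :
    IsLeast {μ : ℝ | Module.End.HasEigenvalue (Matrix.toLin' (secondMoment ν)) μ} lam
  pos : 0 < lam

/-- The linear contextual bandit with `n` users and `k` arms, parameters `θ_i`, context law `ν` and
Gaussian noise `𝒩(0, σ²)`: in each round, conditionally on the served user and the past data, the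
contexts of the arms are i.i.d. with law `ν`, and the noise is independent of everything that
precedes it. -/
structure IsLinearBandit (P : Measure Ω) (theta : Fin n → Vec d) (ν : Measure (Vec d)) (sigma : ℝ)
    (user : ℕ → Ω → Fin n) (ctx : ℕ → Ω → Fin k → Vec d) (arm : ℕ → Ω → Fin k)
    (noise : ℕ → Ω → ℝ) : Prop where
  measurable_user : ∀ t, Measurable (user t)
  measurable_ctx : ∀ t, Measurable (ctx t)
  measurable_arm : ∀ t, Measurable (arm t)
  measurable_noise : ∀ t, Measurable (noise t)
  ctx_law : ∀ t, P.map (ctx (t + 1)) = Measure.pi fun _ : Fin k => ν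
  ctx_indep : ∀ t, Indep (MeasurableSpace.comap (ctx (t + 1)) inferInstance)
    (past theta user ctx arm noise t ⊔ MeasurableSpace.comap (user (t + 1)) inferInstance) P
  noise_law : ∀ t, P.map (noise (t + 1)) = gaussianReal 0 (sigma ^ 2).toNNReal
  noise_indep : ∀ t, Indep (MeasurableSpace.comap (noise (t + 1)) inferInstance)
    (past theta user ctx arm noise t ⊔ MeasurableSpace.comap
      (fun ω => (user (t + 1) ω, ctx (t + 1) ω, arm (t + 1) ω)) inferInstance) P

/-- The arms are pulled by LOCB: in every round the pulled arm maximizes the value used by the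
Pulling module (ties are broken arbitrarily). -/
def PullsByLOCB (P : Measure Ω) (sigma lam gamma delta alpha : ℝ) (S : Finset (Fin n))
    (theta : Fin n → Vec d) (user : ℕ → Ω → Fin n) (ctx : ℕ → Ω → Fin k → Vec d)
    (arm : ℕ → Ω → Fin k) (noise : ℕ → Ω → ℝ) : Prop :=
  ∀ᵐ ω ∂P, ∀ t : ℕ, ∀ a : Fin k,
    armScore sigma lam gamma delta alpha S (pathOf theta user ctx arm noise ω) t
        (ctx (t + 1) ω a) ≤
      armScore sigma lam gamma delta alpha S (pathOf theta user ctx arm noise ω) t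
        (ctx (t + 1) ω (arm (t + 1) ω))

/-- The users are served evenly: after `q` iterations of `n` rounds, every user has been served
exactly `q` times. -/
def EvenlyServed (p : Path n d) : Prop := ∀ (q : ℕ) (i : Fin n), count p i (q * n) = q

/-! ### The quantities in the bound -/

/-- The threshold `(2 · 32² / λ²) log (2nd / δ') log ((32² / λ²) log (2nd / δ'))`. -/
def threshold (n d : ℕ) (lam delta' : ℝ) : ℝ :=
  2 * 32 ^ 2 / lam ^ 2 * Real.log (2 * n * d / delta') *
    Real.log (32 ^ 2 / lam ^ 2 * Real.log (2 * n * d / delta'))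

/-- `C = λ γ² / (16³ σ²)`. -/
def constC (sigma lam gamma : ℝ) : ℝ := lam * gamma ^ 2 / (16 ^ 3 * sigma ^ 2)

/-- The bound on the number of rounds. -/
def roundBound (sigma lam gamma delta : ℝ) (n d : ℕ) : ℝ :=
  2 * n * d / constC sigma lam gamma * Real.log (n * d / constC sigma lam gamma) +
    2 * n / constC sigma lam gamma *
      (Real.log (2 ^ (d + 1) * n / delta) - (gamma ^ 2 - 256) / (512 * sigma ^ 2)) + n

end LOCB

end

/-! The argument is pathwise, since a radius depends only on the round and on the number of times
its user has been served. As soon as all radii lie below `γ / 8`, the stopping test succeeds for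
every active seed, whatever the clusters are. At a round `T = q n` even service makes all counts
equal to `q`, so one scalar inequality, `radius_lt`, is enough. Past the threshold the logarithmic
corrections in `hFun` cost at most half of its main term, leaving `hFun ≥ λ q / 8` (`hFun_ge`). What
remains is an inequality of the form "constant times `d log T` is less than `q`", and the bound is
what results from linearizing the logarithm. `exists_termTime_eq` chooses `q`: the last multiple of
`n` strictly below the bound is within `n` of it and has `q` past the threshold. Termination before
the bound is thus almost sure, which is stronger than probability `1 - δ`. The growth rates follow
from one estimate uniform in `d`, `abs_roundBound_le`. -/

namespace LOCB

/-! ### The confidence radius beyond the threshold -/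

/-- This inverts `M ≥ 2 A log A`, with `A = 32² L / λ²`: for `M = A w` the hypothesis says `log A ≤
w / 2`, while `log w` is at most `w / 4 + 1`. The sum of logarithms is then linear in `w` and `L`,
hence absorbed by `w L`. The constant `400 = 20²` suits the square root in `hFun_ge`. -/
lemma log_add_three_add_le {lam L M : ℝ} (hlam : 0 < lam) (hlam1 : lam ≤ 1)
    (hL : Real.log 2 ≤ L)
    (hM : 2 * 32 ^ 2 / lam ^ 2 * L * Real.log (32 ^ 2 / lam ^ 2 * L) ≤ M) :
    3 ≤ M ∧ Real.log (M + 3) + L ≤ lam ^ 2 * M / 400 := by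
  have h2 := Real.log_two_gt_d9
  have h2' := Real.log_two_lt_d9
  have hL0 : 0 < L := by linarith
  set A : ℝ := 32 ^ 2 / lam ^ 2 * L with hA
  have hlam2 : 0 < lam ^ 2 := by positivity
  have hlam2' : lam ^ 2 ≤ 1 := by nlinarith
  have hA1 : 700 ≤ A := by
    have h : (32 : ℝ) ^ 2 ≤ 32 ^ 2 / lam ^ 2 := by
      rw [le_div_iff₀ hlam2]; nlinarith
    nlinarith
  have hA0 : 0 < A := by linarith
  have hlogA : 6 ≤ Real.log A := by
    rw [Real.le_log_iff_exp_le hA0]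
    have he : Real.exp 6 = Real.exp 1 ^ 6 := by rw [← Real.exp_nat_mul]; norm_num
    have : Real.exp 1 ^ 6 ≤ 2.7182818286 ^ 6 :=
      pow_le_pow_left₀ (Real.exp_pos 1).le Real.exp_one_lt_d9.le 6
    rw [he]; norm_num at this; linarith
  have hM' : 2 * A * Real.log A ≤ M := by
    refine le_trans (le_of_eq ?_) hM
    rw [hA]; ring
  have hM3 : 3 ≤ M := by nlinarith
  have hM0 : 0 < M := by linarith
  refine ⟨hM3, ?_⟩
  obtain ⟨w, rfl⟩ : ∃ w, M = A * w := ⟨M / A, by field_simp⟩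
  have hw : 2 * Real.log A ≤ w := by
    refine le_of_mul_le_mul_left ?_ hA0
    linarith
  have hw0 : 0 < w := by linarith
  -- `M ≥ 3` gives `M + 3 ≤ 2 M`.
  have hlog : Real.log (A * w + 3) ≤ Real.log 2 + (Real.log A + Real.log w) := by
    rw [← Real.log_mul hA0.ne' hw0.ne', ← Real.log_mul two_ne_zero hM0.ne']
    exact Real.log_le_log (by linarith) (by linarith)
  have hlogw : Real.log w ≤ w / 4 + 1 := by
    have h4 : Real.log w = Real.log (w / 4) + 2 * Real.log 2 := by
      rw [Real.log_div hw0.ne' (by norm_num), show (4 : ℝ) = 2 ^ 2 by norm_num, Real.log_pow]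
      push_cast; ring
    have := Real.log_le_sub_one_of_pos (show 0 < w / 4 by positivity)
    linarith
  have hE : lam ^ 2 * (A * w) / 400 = 2.56 * (w * L) := by
    rw [hA]; field_simp; norm_num
  rw [hE]
  have hwL : 0.69 * w ≤ w * L := by nlinarith
  have hwL' : 12 * L ≤ w * L := by nlinarith
  linarith

lemma hFun_ge {lam H : ℝ} {m : ℕ} (hlam : 0 < lam) (hlam1 : lam ≤ 1) (hH : 0 < H)
    (hL : Real.log 2 ≤ Real.log (1 / H))
    (hm : 2 * 32 ^ 2 / lam ^ 2 * Real.log (1 / H) *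
      Real.log (32 ^ 2 / lam ^ 2 * Real.log (1 / H)) ≤ m) :
    lam * m / 8 ≤ hFun lam m H := by
  obtain ⟨hm3, hl⟩ := log_add_three_add_le hlam hlam1 hL hm
  have hlog : Real.log ((m + 3) / H) = Real.log (m + 3) + Real.log (1 / H) := by
    rw [← Real.log_mul (by positivity) (by positivity)]; congr 1; ring
  rw [← hlog] at hl
  have hs : √(m * Real.log ((m + 3) / H)) ≤ lam * m / 20 := by
    refine Real.sqrt_le_iff.2 ⟨by positivity, ?_⟩
    calc (m : ℝ) * Real.log ((m + 3) / H) ≤ m * (lam ^ 2 * m / 400) := by gcongr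
      _ = (lam * m / 20) ^ 2 := by ring
  have hlm : lam ^ 2 * m ≤ lam * m := by
    have : lam ^ 2 ≤ lam := by nlinarith
    gcongr
  have : 0 ≤ lam * m := by positivity
  -- The budget is `1/4 - 8/400 - 2/20 = 0.13 ≥ 1/8`, in units of `λ m`; `λ ≤ 1` turns `λ² m` into
  -- `λ m`.
  refine le_trans ?_ (le_max_right _ _)
  linarith

/-- The radius is below `γ / 8` in round `q n` if every user has been served `q` times, `q` is
beyond the threshold, and `q n` is within `n` rounds of the bound. -/
lemma radius_lt {sigma lam gamma delta : ℝ} {n d q : ℕ} (hsigma : 0 < sigma) (hlam : 0 < lam)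
    (hlam1 : lam ≤ 1) (hgamma : 0 < gamma) (hdelta : 0 < delta) (hdelta' : delta < 1)
    (hn : 0 < n) (hd : 0 < d) (hq0 : 0 < q) (hq : threshold n d lam (delta / n) ≤ q)
    (hU : roundBound sigma lam gamma delta n d - n ≤ (q : ℝ) * n) :
    radius n d sigma lam (delta / n) (q * n) q < gamma / 8 := by
  have hn1 : (1 : ℝ) ≤ n := by exact_mod_cast hn
  have hd1 : (1 : ℝ) ≤ d := by exact_mod_cast hd
  have hq1 : (1 : ℝ) ≤ q := by exact_mod_cast hq0
  have h2 := Real.log_two_gt_d9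
  have hinv : 1 / (delta / n / (2 * n * d)) = 2 * n * d / (delta / n) := by
    field_simp
  have hL : Real.log 2 ≤ Real.log (1 / (delta / n / (2 * n * d))) := by
    refine Real.log_le_log two_pos ?_
    rw [hinv, le_div_iff₀ (by positivity)]
    have : delta / n ≤ 1 := by rw [div_le_one (by positivity)]; linarith
    nlinarith [mul_le_mul hn1 hd1 zero_le_one (by positivity)]
  have hh : lam * q / 8 ≤ hFun lam q (delta / n / (2 * n * d)) := by
    refine hFun_ge hlam hlam1 (by positivity) hL ?_
    rw [hinv]; exact hq
  set C := constC sigma lam gamma with hC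
  have hC0 : 0 < C := by rw [hC, constC]; positivity
  have hCe : lam * gamma ^ 2 = 4096 * sigma ^ 2 * C := by
    rw [hC, constC]; field_simp; norm_num
  set T : ℝ := (q : ℝ) * n with hT
  have hT1 : 1 ≤ T := by nlinarith
  set v := Real.log (2 / (delta / n)) with hv
  have hv0 : 0 < v := Real.log_pos (by
    rw [lt_div_iff₀ (by positivity), one_mul, div_lt_iff₀ (by positivity)]; linarith)
  set u := Real.log (n * d / C) with hu
  have hpow : Real.log (2 ^ (d + 1) * n / delta) = d * Real.log 2 + v := by
    rw [hv, ← Real.log_pow, ← Real.log_mul (by positivity) (by positivity)]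
    congr 1; field_simp; ring
  -- In units of `4 σ²`, the two terms of `(γ / 8)² (1 + λ q / 8)` are `G` and `2 C q`, and the
  -- additive constant `2` from squaring the numerator is `e`.
  set G := gamma ^ 2 / (256 * sigma ^ 2) with hG
  have hG0 : 0 < G := by positivity
  set e := 1 / (2 * sigma ^ 2) with he
  have he0 : 0 < e := by positivity
  have hGe : (gamma ^ 2 - 256) / (512 * sigma ^ 2) = (G - 2 * e) / 2 := by
    rw [hG, he]; field_simp; ring
  have hU' : 2 * d * u + 2 * (d * Real.log 2 + v) - (G - 2 * e) ≤ C * q := by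
    rw [roundBound, ← hC, ← hu, hpow, hGe] at hU
    have h3 : 2 * n * d / C * u + 2 * n / C * (d * Real.log 2 + v - (G - 2 * e) / 2) =
      n / C * (2 * d * u + 2 * (d * Real.log 2 + v) - (G - 2 * e)) := by
      field_simp; ring
    have h4 : n / C * (2 * d * u + 2 * (d * Real.log 2 + v) - (G - 2 * e)) ≤ n / C * (C * q) := by
      rw [← h3]
      calc _ ≤ T := by linarith
        _ = n / C * (C * q) := by rw [hT]; field_simp
    exact le_of_mul_le_mul_left h4 (by positivity)
  -- Since `T = (C q / d) (n d / C)`, applying `log x ≤ x - 1` at `x = C q / d` costs one `C q`,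
  -- half of the available `2 C q`.
  have hlogT : d * Real.log T ≤ C * q + d * u - d := by
    have h5 : Real.log T = Real.log (C * q / d) + u := by
      rw [hu, ← Real.log_mul (by positivity) (by positivity)]
      congr 1; rw [hT]; field_simp
    have h6 := Real.log_le_sub_one_of_pos (show 0 < C * q / d by positivity)
    calc d * Real.log T ≤ d * (C * q / d - 1 + u) := by rw [h5]; gcongr
      _ = C * q + d * u - d := by field_simp; ring
  have hCq : 0 < C * q := by positivity
  have hlogT0 : 0 ≤ Real.log T := Real.log_nonneg hT1
  have hdl : 0 ≤ d * Real.log 2 := by positivity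
  have key : d * Real.log T + v < G - e + 2 * (C * q) := by
    -- If this quantity is nonnegative, `hU'` supplies the missing `C q`; if it is negative, `u` is
    -- so small that `hlogT` alone suffices.
    by_cases hc : 0 ≤ d * u + v + d + 2 * (d * Real.log 2) + e
    · linarith
    · linarith
  have hsq : (sigma * √(2 * d * Real.log T + 2 * v) + 1) ^ 2 <
      (gamma / 8) ^ 2 * (1 + lam * q / 8) := by
    have hs : √(2 * d * Real.log T + 2 * v) ^ 2 = 2 * d * Real.log T + 2 * v :=
      Real.sq_sqrt (by positivity)
    -- This is `(a + 1)² ≤ 2 a² + 2`.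
    calc _ ≤ 2 * (sigma ^ 2 * √(2 * d * Real.log T + 2 * v) ^ 2) + 2 := by
          nlinarith [sq_nonneg (sigma * √(2 * d * Real.log T + 2 * v) - 1)]
      _ = 4 * sigma ^ 2 * (d * Real.log T + v) + 2 := by rw [hs]; ring
      _ < 4 * sigma ^ 2 * (G - e + 2 * (C * q)) + 2 := by gcongr
      _ = gamma ^ 2 / 64 + 4096 * sigma ^ 2 * C * q / 512 := by
          rw [hG, he]; field_simp; ring
      _ = _ := by rw [← hCe]; ring
  have hpos : 0 ≤ hFun lam q (delta / n / (2 * n * d)) := le_max_left _ _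
  rw [radius, Nat.cast_mul, ← hT, ← hv, div_lt_iff₀ (by positivity)]
  refine lt_of_pow_lt_pow_left₀ 2 (by positivity) (hsq.trans_le ?_)
  rw [mul_pow, Real.sq_sqrt (by positivity)]
  gcongr

lemma threshold_pos {n d : ℕ} {lam delta : ℝ} (hlam : 0 < lam) (hlam1 : lam ≤ 1)
    (hdelta : 0 < delta) (hdelta' : delta < 1) (hn : 0 < n) (hd : 0 < d) :
    0 < threshold n d lam (delta / n) := by
  have hn1 : (1 : ℝ) ≤ n := by exact_mod_cast hn
  have hd1 : (1 : ℝ) ≤ d := by exact_mod_cast hd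
  have hL : Real.log 2 ≤ Real.log (2 * n * d / (delta / n)) := by
    refine Real.log_le_log two_pos ?_
    rw [le_div_iff₀ (by positivity)]
    have : delta / n ≤ 1 := by rw [div_le_one (by positivity)]; linarith
    nlinarith [mul_le_mul hn1 hd1 zero_le_one (by positivity)]
  have := (log_add_three_add_le hlam hlam1 hL le_rfl).1
  rw [threshold]; linarith

/-! ### Termination along a path -/

lemma sum_count {n d : ℕ} (p : Path n d) (t : ℕ) : ∑ i, count p i t = t := by
  have := Finset.card_eq_sum_card_fiberwise (f := p.user) (s := Finset.Icc 1 t)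
    (t := Finset.univ) (fun _ _ => Finset.mem_coe.2 (Finset.mem_univ _))
  simpa [count, served] using this.symm

/-- Pigeonhole: the counts sum to `t < (q + 1) n`, so some user has been served at most `q` times.
This carries the threshold from an arbitrary round to a multiple of `n`. -/
lemma le_of_forall_le_count {n d : ℕ} (p : Path n d) {t q : ℕ} {c : ℝ} (ht : t < (q + 1) * n)
    (hc : ∀ i, c ≤ (count p i t : ℝ)) : c ≤ q := by
  obtain ⟨i, hi⟩ : ∃ i, count p i t ≤ q := by
    by_contra! h
    have h1 : ∑ _i : Fin n, (q + 1) ≤ ∑ i, count p i t := Finset.sum_le_sum fun i _ => h i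
    rw [sum_count] at h1
    simp only [Finset.sum_const, Finset.card_univ, Fintype.card_fin, smul_eq_mul] at h1
    linarith [mul_comm n (q + 1)]
  exact (hc i).trans (by exact_mod_cast hi)

/-- Round `0` is excluded because the stopping test is first applied at the end of round `1`. -/
lemma termTime_le {n d : ℕ} {sigma lam gamma delta : ℝ} {S : Finset (Fin n)} {p : Path n d}
    {t : ℕ} (ht : 0 < t)
    (hB : ∀ i, radius n d sigma lam (delta / n) t (count p i t) < gamma / 8) :
    termTime sigma lam gamma delta S p ≤ t := by
  refine sInf_le ⟨t, ?_, rfl⟩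
  obtain ⟨t, rfl⟩ := Nat.exists_eq_succ_of_ne_zero ht.ne'
  simp only [Set.mem_ofPred_eq, clusterState, clusterStep]
  exact Finset.filter_false_of_mem fun s _ h => h fun i _ => hB i

lemma exists_termTime_eq {n d : ℕ} {sigma lam gamma delta : ℝ} {S : Finset (Fin n)}
    {p : Path n d} (hsigma : 0 < sigma) (hlam : 0 < lam) (hlam1 : lam ≤ 1) (hgamma : 0 < gamma)
    (hdelta : 0 < delta) (hdelta' : delta < 1) (hn : 0 < n) (hd : 0 < d) (hp : EvenlyServed p)
    {t : ℕ} (ht : (t : ℕ∞) < termTime sigma lam gamma delta S p ∨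
      (t : ℝ) < roundBound sigma lam gamma delta n d)
    (hc : ∀ i, threshold n d lam (delta / n) ≤ (count p i t : ℝ)) :
    ∃ T : ℕ, termTime sigma lam gamma delta S p = T ∧
      (T : ℝ) < roundBound sigma lam gamma delta n d := by
  set U := roundBound sigma lam gamma delta n d with hU
  have hn0 : (0 : ℝ) < n := by exact_mod_cast hn
  have hthr := threshold_pos hlam hlam1 hdelta hdelta' hn hd
  have step : ∀ q : ℕ, t < (q + 1) * n → U - n ≤ (q : ℝ) * n →
      termTime sigma lam gamma delta S p ≤ (q * n : ℕ) := by
    intro q htq hUq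
    have hq := le_of_forall_le_count p htq hc
    have hq0 : 0 < q := by exact_mod_cast hthr.trans_le hq
    refine termTime_le (Nat.mul_pos hq0 hn) fun i => ?_
    rw [hp q i]
    exact radius_lt hsigma hlam hlam1 hgamma hdelta hdelta' hn hd hq0 hq hUq
  -- If `t` were at or past the bound, then `(t / n) n > t - n ≥ U - n`, and `step` would force
  -- termination by a round not later than `t`.
  have htU : (t : ℝ) < U := by
    refine ht.elim (fun h => ?_) id
    by_contra! hUt
    have h1 : t < (t / n + 1) * n := by
      rw [mul_comm]; exact Nat.lt_mul_div_succ t hn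
    have h1' : (t : ℝ) < ((t / n : ℕ) + 1) * n := by exact_mod_cast h1
    have h2 := step (t / n) h1 (by linarith)
    exact absurd (h.trans_le h2) (not_lt.2 (by exact_mod_cast Nat.div_mul_le_self t n))
  have hU0 : 0 < U := (Nat.cast_nonneg t).trans_lt htU
  -- This `q` is the largest with `q n < U`; hence `t < U ≤ (q + 1) n`, as `step` requires.
  obtain ⟨q, hq⟩ : ∃ q, ⌈U / n⌉₊ = q + 1 :=
    Nat.exists_eq_succ_of_ne_zero (Nat.ceil_pos.2 (by positivity)).ne'
  have hq1 : U ≤ ((q : ℝ) + 1) * n := by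
    have := Nat.le_ceil (U / n)
    rw [hq, div_le_iff₀ hn0] at this
    exact_mod_cast this
  have hq2 : (q : ℝ) * n < U := by
    have : q < ⌈U / n⌉₊ := by omega
    rwa [Nat.lt_ceil, lt_div_iff₀ hn0] at this
  have h := step q (by exact_mod_cast htU.trans_le hq1) (by linarith)
  obtain ⟨T, hT⟩ := ENat.ne_top_iff_exists.1 (h.trans_lt (ENat.natCast_lt_top _)).ne
  refine ⟨T, hT.symm, ?_⟩
  rw [← hT] at h
  have hTq : (T : ℝ) ≤ (q : ℝ) * n := by exact_mod_cast h
  linarith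

/-! ### The context law -/

lemma IsContextLaw.dim_pos {d : ℕ} {ν : Measure (Vec d)} {lam : ℝ} (h : IsContextLaw ν lam) :
    0 < d := by
  have := h.isProbabilityMeasure
  obtain ⟨x, hx⟩ := h.norm_eq_one.exists
  rcases Nat.eq_zero_or_pos d with rfl | hd
  · rw [Subsingleton.elim x 0, norm_zero] at hx
    exact absurd hx zero_ne_one
  · exact hd

/-- For an eigenvector `w`, `λ ‖w‖² = E⟨w, X⟩² ≤ ‖w‖²` by Cauchy–Schwarz and `‖X‖ = 1`. -/
lemma IsContextLaw.le_one {d : ℕ} {ν : Measure (Vec d)} {lam : ℝ} (h : IsContextLaw ν lam) :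
    lam ≤ 1 := by
  have := h.isProbabilityMeasure
  obtain ⟨v, hv⟩ := h.isLeast_eigenvalue.1.exists_hasEigenvector
  have hv0 := hv.2
  have hev : secondMoment ν *ᵥ v = lam • v := by simpa using hv.apply_eq_smul
  set w : Vec d := WithLp.toLp 2 v with hw
  have hint : ∀ a b, Integrable (fun x : Vec d => x a * x b) ν := by
    intro a b
    refine Integrable.of_bound (C := 1) (by fun_prop) ?_
    filter_upwards [h.norm_eq_one] with x hx
    have ha := PiLp.norm_apply_le x a
    have hb := PiLp.norm_apply_le x b
    rw [hx] at ha hb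
    rw [norm_mul]
    exact mul_le_one₀ ha (norm_nonneg _) hb
  have hquad : lam * ‖w‖ ^ 2 = ∫ x, inner ℝ w x ^ 2 ∂ν := by
    have h1 : lam * ‖w‖ ^ 2 = v ⬝ᵥ secondMoment ν *ᵥ v := by
      rw [hev, dotProduct_smul, smul_eq_mul, EuclideanSpace.real_norm_sq_eq]
      simp [dotProduct, hw, pow_two]
    have h2 : ∀ x : Vec d, inner ℝ w x ^ 2 = ∑ a, ∑ b, v a * v b * (x a * x b) := by
      intro x
      have : inner ℝ w x = ∑ a, v a * x a := by
        simp [PiLp.inner_apply, hw, mul_comm]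
      rw [this, pow_two, Finset.sum_mul_sum]
      exact Finset.sum_congr rfl fun a _ => Finset.sum_congr rfl fun b _ => by ring
    simp_rw [h2]
    rw [h1, integral_finsetSum _ fun a _ => integrable_finsetSum _ fun b _ =>
      (hint a b).const_mul _]
    refine Finset.sum_congr rfl fun a _ => ?_
    rw [integral_finsetSum _ fun b _ => (hint a b).const_mul _, Matrix.mulVec, dotProduct,
      Finset.mul_sum]
    refine Finset.sum_congr rfl fun b _ => ?_
    rw [integral_const_mul]
    simp only [secondMoment, Matrix.of_apply]
    ring
  have hle : ∫ x, inner ℝ w x ^ 2 ∂ν ≤ ∫ _x, ‖w‖ ^ 2 ∂ν := by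
    refine integral_mono_of_nonneg (ae_of_all _ fun x => sq_nonneg _) (integrable_const _) ?_
    filter_upwards [h.norm_eq_one] with x hx
    have := abs_real_inner_le_norm w x
    rw [hx, mul_one] at this
    exact sq_le_sq' (abs_le.1 this).1 (abs_le.1 this).2
  rw [← hquad, integral_const, probReal_univ, one_smul] at hle
  have hw0 : w ≠ 0 := fun h0 => hv0 (by simpa [hw] using h0)
  have : 0 < ‖w‖ ^ 2 := by positivity
  exact le_of_mul_le_mul_right (by linarith) this

/-! ### Growth of the bound -/

/-- The factor `d + 1` in place of `d` keeps the estimate valid at `d = 0`, and `n ≥ 3 > e` makes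
the logarithm at least `1`, so that it absorbs constants. Both asymptotic claims specialize this
estimate. -/
lemma abs_roundBound_le (sigma lam gamma delta : ℝ) (hsigma : 0 < sigma) (hlam : 0 < lam)
    (hgamma : 0 < gamma) (hdelta : 0 < delta) :
    ∃ K : ℝ, 0 ≤ K ∧ ∀ n d : ℕ, 3 ≤ n → |roundBound sigma lam gamma delta n d| ≤
      K * (n * (d + 1) * Real.log (n * (d + 1))) := by
  set C := constC sigma lam gamma with hC
  have hC0 : 0 < C := by rw [hC, constC]; positivity
  set c := (gamma ^ 2 - 256) / (512 * sigma ^ 2) with hc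
  refine ⟨2 / C * (1 + |Real.log C|) + 2 / C * (2 + |Real.log delta| + |c|) + 1, by positivity,
    fun n d hn => ?_⟩
  have hn3 : (3 : ℝ) ≤ n := by exact_mod_cast hn
  have hd0 : (0 : ℝ) ≤ d := Nat.cast_nonneg d
  set N : ℝ := n * (d + 1) with hN
  have hnN : (n : ℝ) ≤ N := by rw [hN]; nlinarith
  set Λ := Real.log N with hΛ
  have hΛn : Real.log n ≤ Λ := Real.log_le_log (by positivity) hnN
  have hΛ1 : 1 ≤ Λ := by
    rw [hΛ, Real.le_log_iff_exp_le (by linarith)]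
    linarith [Real.exp_one_lt_d9]
  have hlog0 : 0 ≤ Real.log n := Real.log_nonneg (by linarith)
  have t1 : |2 * n * d / C * Real.log (n * d / C)| ≤ 2 / C * (1 + |Real.log C|) * (N * Λ) := by
    rcases Nat.eq_zero_or_pos d with rfl | hd
    · simp only [Nat.cast_zero, mul_zero, zero_div, zero_mul, abs_zero]
      have : 0 ≤ N := by linarith
      positivity
    have hd1 : (1 : ℝ) ≤ d := by exact_mod_cast hd
    have h1 : |Real.log (n * d / C)| ≤ (1 + |Real.log C|) * Λ := by
      rw [Real.log_div (by positivity) hC0.ne']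
      refine (abs_sub _ _).trans ?_
      have h2 : 0 ≤ Real.log (n * d : ℝ) := Real.log_nonneg (by nlinarith)
      have h3 : Real.log (n * d : ℝ) ≤ Λ :=
        Real.log_le_log (by positivity) (by rw [hN]; nlinarith)
      rw [abs_of_nonneg h2]
      nlinarith [abs_nonneg (Real.log C)]
    rw [abs_mul, abs_of_nonneg (by positivity)]
    have h4 : 2 * n * d / C ≤ 2 * N / C := by
      gcongr ?_ / C
      rw [hN]; nlinarith
    calc _ ≤ 2 * N / C * ((1 + |Real.log C|) * Λ) := by gcongr
      _ = _ := by ring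
  have t2 : |2 * n / C * (Real.log (2 ^ (d + 1) * n / delta) - c)| ≤
      2 / C * (2 + |Real.log delta| + |c|) * (N * Λ) := by
    have h1 : |Real.log (2 ^ (d + 1) * n / delta) - c| ≤
        (d + 1) * ((2 + |Real.log delta| + |c|) * Λ) := by
      rw [Real.log_div (by positivity) hdelta.ne', Real.log_mul (by positivity) (by positivity),
        Real.log_pow]
      push_cast
      have h2 := Real.log_two_gt_d9
      have h2' := Real.log_two_lt_d9
      have h3 : |(d + 1) * Real.log 2 + Real.log n - Real.log delta - c| ≤
          (d + 1) + Λ + |Real.log delta| + |c| := by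
        refine (abs_sub _ _).trans (add_le_add_left ((abs_sub _ _).trans (add_le_add_left ?_ _)) _)
        rw [abs_of_nonneg (by positivity)]
        nlinarith
      refine h3.trans ?_
      have e1 : |Real.log delta| ≤ (d + 1) * (|Real.log delta| * Λ) := by
        have : (1 : ℝ) ≤ (d + 1) * Λ := by nlinarith
        nlinarith [abs_nonneg (Real.log delta)]
      have e2 : |c| ≤ (d + 1) * (|c| * Λ) := by
        have : (1 : ℝ) ≤ (d + 1) * Λ := by nlinarith
        nlinarith [abs_nonneg c]
      nlinarith
    rw [abs_mul, abs_of_nonneg (by positivity)]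
    calc _ ≤ 2 * n / C * ((d + 1) * ((2 + |Real.log delta| + |c|) * Λ)) := by gcongr
      _ = _ := by rw [hN]; ring
  have t3 : |(n : ℝ)| ≤ 1 * (N * Λ) := by
    rw [abs_of_nonneg (by positivity)]; nlinarith
  rw [roundBound, ← hC, ← hc]
  calc _ ≤ _ := (abs_add_le _ _).trans (add_le_add_left (abs_add_le _ _) _)
    _ ≤ _ := add_le_add (add_le_add t1 t2) t3
    _ = _ := by ring

lemma isBigO_roundBound_left (sigma lam gamma delta : ℝ) (hsigma : 0 < sigma) (hlam : 0 < lam)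
    (hgamma : 0 < gamma) (hdelta : 0 < delta) (d : ℕ) :
    (fun n : ℕ => roundBound sigma lam gamma delta n d) =O[atTop]
      fun n : ℕ => (n : ℝ) * Real.log n := by
  obtain ⟨K, hK0, hK⟩ := abs_roundBound_le sigma lam gamma delta hsigma hlam hgamma hdelta
  refine IsBigO.of_bound (K * ((d + 1) * (1 + Real.log (d + 1)))) ?_
  filter_upwards [eventually_ge_atTop 3] with n hn
  have hn3 : (3 : ℝ) ≤ n := by exact_mod_cast hn
  have hl : 1 ≤ Real.log n := by
    rw [Real.le_log_iff_exp_le (by linarith)]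
    linarith [Real.exp_one_lt_d9]
  have hld : 0 ≤ Real.log (d + 1 : ℝ) := Real.log_nonneg (by linarith [Nat.cast_nonneg (α := ℝ) d])
  rw [Real.norm_eq_abs, Real.norm_eq_abs, abs_of_nonneg (a := (n : ℝ) * Real.log n) (by positivity)]
  calc _ ≤ K * (n * (d + 1) * Real.log (n * (d + 1))) := hK n d hn
    _ ≤ K * (n * (d + 1) * ((1 + Real.log (d + 1)) * Real.log n)) := by
        rw [Real.log_mul (by positivity) (by positivity)]
        gcongr
        nlinarith
    _ = _ := by ring

lemma isBigO_roundBound_prod (sigma lam gamma delta : ℝ) (hsigma : 0 < sigma) (hlam : 0 < lam)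
    (hgamma : 0 < gamma) (hdelta : 0 < delta) :
    (fun q : ℕ × ℕ => roundBound sigma lam gamma delta q.1 q.2) =O[atTop]
      fun q : ℕ × ℕ => (q.1 : ℝ) * q.2 * Real.log (q.1 * q.2) := by
  obtain ⟨K, hK0, hK⟩ := abs_roundBound_le sigma lam gamma delta hsigma hlam hgamma hdelta
  refine IsBigO.of_bound (K * 4) ?_
  filter_upwards [eventually_ge_atTop ((3, 1) : ℕ × ℕ)] with q hq
  obtain ⟨n, d⟩ := q
  obtain ⟨hn, hd⟩ : 3 ≤ n ∧ 1 ≤ d := hq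
  have hn3 : (3 : ℝ) ≤ n := by exact_mod_cast hn
  have hd1 : (1 : ℝ) ≤ d := by exact_mod_cast hd
  have hnd : (3 : ℝ) ≤ n * d := by nlinarith
  have hl : 1 ≤ Real.log (n * d : ℝ) := by
    rw [Real.le_log_iff_exp_le (by linarith)]
    linarith [Real.exp_one_lt_d9]
  have h2' := Real.log_two_lt_d9
  simp only
  rw [Real.norm_eq_abs, Real.norm_eq_abs,
    abs_of_nonneg (a := (n : ℝ) * d * Real.log (n * d)) (by positivity)]
  have hlog : Real.log (n * (d + 1) : ℝ) ≤ 2 * Real.log (n * d : ℝ) := by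
    calc _ ≤ Real.log (2 * (n * d) : ℝ) := Real.log_le_log (by positivity) (by nlinarith)
      _ = Real.log 2 + Real.log (n * d : ℝ) := Real.log_mul two_ne_zero (by positivity)
      _ ≤ _ := by linarith
  have hdd : (d + 1 : ℝ) ≤ 2 * d := by linarith
  calc _ ≤ K * (n * (d + 1) * Real.log (n * (d + 1))) := hK n d hn
    _ ≤ K * (n * (2 * d) * (2 * Real.log (n * d))) := by
        have : 0 ≤ Real.log (n * (d + 1) : ℝ) := Real.log_nonneg (by nlinarith)
        gcongr
    _ = _ := by ring

end LOCB

theorem theorem2 (sigma lam gamma delta : ℝ) (hsigma : 0 < sigma) (hlam : 0 < lam)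
    (hgamma : 0 < gamma) (hdelta : 0 < delta) (hdelta' : delta < 1) :
    (∀ (n d k : ℕ) (Ω : Type*) [MeasurableSpace Ω] (P : Measure Ω) [IsProbabilityMeasure P]
        (theta : Fin n → LOCB.Vec d) (ν : Measure (LOCB.Vec d)) (alpha : ℝ) (S : Finset (Fin n))
        (user : ℕ → Ω → Fin n) (ctx : ℕ → Ω → Fin k → LOCB.Vec d) (arm : ℕ → Ω → Fin k)
        (noise : ℕ → Ω → ℝ),
      LOCB.IsContextLaw ν lam →
      LOCB.IsLinearBandit P theta ν sigma user ctx arm noise →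
      LOCB.PullsByLOCB P sigma lam gamma delta alpha S theta user ctx arm noise →
      -- users are served evenly
      (∀ᵐ ω ∂P, LOCB.EvenlyServed (LOCB.pathOf theta user ctx arm noise ω)) →
      -- all counts have reached the threshold at a round before termination or before the bound
      (∀ᵐ ω ∂P, ∃ t : ℕ,
        ((t : ℕ∞) < LOCB.termTime sigma lam gamma delta S
              (LOCB.pathOf theta user ctx arm noise ω) ∨
            (t : ℝ) < LOCB.roundBound sigma lam gamma delta n d) ∧
          ∀ i : Fin n, LOCB.threshold n d lam (delta / n) ≤
            (LOCB.count (LOCB.pathOf theta user ctx arm noise ω) i t : ℝ)) →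
      1 - delta ≤ P.real {ω | ∃ T : ℕ,
        LOCB.termTime sigma lam gamma delta S (LOCB.pathOf theta user ctx arm noise ω) = T ∧
          (T : ℝ) < LOCB.roundBound sigma lam gamma delta n d}) ∧
    (∀ d : ℕ, (fun n : ℕ => LOCB.roundBound sigma lam gamma delta n d) =O[atTop]
      fun n : ℕ => (n : ℝ) * Real.log n) ∧
    ((fun q : ℕ × ℕ => LOCB.roundBound sigma lam gamma delta q.1 q.2) =O[atTop]
      fun q : ℕ × ℕ => (q.1 : ℝ) * q.2 * Real.log (q.1 * q.2)) := by
  refine ⟨?_, LOCB.isBigO_roundBound_left sigma lam gamma delta hsigma hlam hgamma hdelta,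
    LOCB.isBigO_roundBound_prod sigma lam gamma delta hsigma hlam hgamma hdelta⟩
  intro n d k Ω _ P _ theta ν alpha S user ctx arm noise hν _ _ heven hcount
  obtain ⟨ω₀⟩ := nonempty_of_isProbabilityMeasure P
  -- The sample space is nonempty, so a served user exists.
  have hn : 0 < n := Fin.pos (user 0 ω₀)
  have hae : ∀ᵐ ω ∂P, ∃ T : ℕ,
      LOCB.termTime sigma lam gamma delta S (LOCB.pathOf theta user ctx arm noise ω) = T ∧
        (T : ℝ) < LOCB.roundBound sigma lam gamma delta n d := by
    filter_upwards [heven, hcount] with ω he ⟨t, ht, hc⟩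
    exact LOCB.exists_termTime_eq hsigma hlam hν.le_one hgamma hdelta hdelta' hn hν.dim_pos he ht hc
  have hone : P.real {ω | ∃ T : ℕ,
      LOCB.termTime sigma lam gamma delta S (LOCB.pathOf theta user ctx arm noise ω) = T ∧
        (T : ℝ) < LOCB.roundBound sigma lam gamma delta n d} = 1 := by
    rw [measureReal_congr (eventuallyEq_univ.2 hae), probReal_univ]
  linarith
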